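/- A quantum factor graph (QFG) $\mathcal G$ consists of a finite bipartite graph with variable vertices $\mathcal V$ and factor vertices $\mathcal F$ (write $\partial a\subseteq\mathcal V$ for the set of neighbours of $a\in\mathcal F$), a finite-dimensional non-zero complex Hilbert space $\mathcal H_i$ for each $i\in\mathcal V$, and a positive semidefinite operator $\rho_a$ on $\bigotimes_{i\in\partial a}\mathcal H_i$ for each $a\in\mathcal F$. The $\star$-product of positive definite operators on one space is $\bigstar_a\rho_a=\exp\bigl(\sum_a\log\rho_a\bigr)$; for positive semidefinite operators it is $\lim_{\varepsilon\downarrow0}\bigstar_a(\rho_a+\varepsilon I)$. Operators on different tensor products are first tensored with identities so as to act on a common one. The global operator of $\mathcal G$ is $\rho=\bigstar_{a\in\mathcal F}\rho_a$ on $\bigotimes_{i\in\mathcal V}\mathcal H_i$, and the partition sum is $Z(\mathcal G)=\operatorname{tr}\rho$. A box consists of sets $\mathcal V'\subseteq\mathcal V$ and $\mathcal F'\subseteq\mathcal F$ such that every neighbour of a vertex of $\mathcal V'$ lies in $\mathcal F'$. Closing the box replaces it by one new factor vertex, adjacent to the variable vertices outside $\mathcal V'$ that are adjacent to some $a\in\mathcal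 F'$, which carries the operator $\operatorname{tr}_{\mathcal V'}\bigl(\bigstar_{a\in\mathcal F'}\rho_a\bigr)$ (the partial trace over the $\mathcal H_i$, $i\in\mathcal V'$); the result is again a QFG. **Theorem.** Let $\mathcal G$ be a QFG whose bipartite graph is acyclic. (1) There is a finite sequence of closing-the-box operations, each with exactly one variable vertex in its box (so that each traces out exactly one Hilbert space), which depends only on the graph and leads to a trivial QFG: one without variable vertices, and with exactly one factor vertex if $\mathcal V\neq\emptyset$. (2) Fix any such sequence that leads to a graph without variable vertices. For every choice of the $\rho_a$, the global operator of the resulting QFG is a constant $\hat Z\ge0$ on the one-dimensional Hilbert space $\mathbb C$. Moreover, for all Hermitian operators $H_a$ on $\bigotimes_{i\in\partial a}\mathcal H_i$ $(a\in\mathcal F)$ there are $C>0$ and $\delta>0$ such that, for all real $t$ with $|t|<\delta$ and all real $c_a>0$: if $\rho_a=c_a\,(I+tH_a)$ for every $a\in\mathcal F$, then $$\bigl|\hat Z-Z(\mathcal G)\bigr|\le C\Bigl(\prod_{a\in\mathcal F}c_a\Bigr)t^4 .$$ In particular $\hat Z=Z(\mathcal G)+O(t^4)$ as $t\to0$ for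 fixed $c_a$ and $H_a$. -/

import Mathlib

open Filter Topology
open scoped ComplexOrder

universe u v w

namespace QFG

/-! ### The `⋆`-product of positive semidefinite operators -/

section StarProductConvergence

variable {A : Type*} [CStarAlgebra A] [PartialOrder A] [StarOrderedRing A]

theorem tendsto_of_monotone_bounded_aux [FiniteDimensional ℂ A] {R : ℝ → A} {b : A} {r : ℝ}
    (hr : 0 < r) (h0 : ∀ ε, 0 < ε → ε ≤ r → 0 ≤ R ε) (hb : ∀ ε, 0 < ε → ε ≤ r → R ε ≤ b)
    (hmono : ∀ ε ε', 0 < ε → ε ≤ ε' → ε' ≤ r → R ε ≤ R ε') :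
    ∃ L, Tendsto R (𝓝[>] 0) (𝓝 L) := by
  have : ProperSpace A := FiniteDimensional.proper ℂ A
  have hK : IsCompact (Metric.closedBall (0 : A) ‖b‖) := isCompact_closedBall _ _
  have hev : ∀ᶠ ε in 𝓝[>] (0 : ℝ), 0 < ε ∧ ε ≤ r := by
    filter_upwards [Ioc_mem_nhdsGT hr] with ε hε using hε
  have hmem : ∀ᶠ ε in 𝓝[>] (0 : ℝ), R ε ∈ Metric.closedBall (0 : A) ‖b‖ := by
    filter_upwards [hev] with ε hε
    simpa using CStarAlgebra.norm_le_norm_of_nonneg_of_le (h0 ε hε.1 hε.2) (hb ε hε.1 hε.2)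
  obtain ⟨L, -, hL⟩ := hK.exists_mapClusterPt_of_frequently hmem.frequently
  have key : ∀ L₁ L₂ : A, MapClusterPt L₁ (𝓝[>] (0 : ℝ)) R → MapClusterPt L₂ (𝓝[>] (0 : ℝ)) R →
      L₁ ≤ L₂ := by
    intro L₁ L₂ h₁ h₂
    have hle : ∀ ε, 0 < ε → ε ≤ r → L₁ ≤ R ε := by
      intro ε hε hεr
      refine isClosed_Iic.mem_of_mapClusterPt h₁ ?_
      filter_upwards [Ioc_mem_nhdsGT hε] with ε' hε'
      exact hmono ε' ε hε'.1 hε'.2 hεr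
    refine isClosed_Ici.mem_of_mapClusterPt h₂ ?_
    filter_upwards [hev] with ε hε using hle ε hε.1 hε.2
  refine ⟨L, hK.tendsto_nhds_of_unique_mapClusterPt hmem ?_⟩
  intro L' _ hL'
  exact le_antisymm (key _ _ hL' hL) (key _ _ hL hL')

theorem tendsto_exp_of_monotone_aux [FiniteDimensional ℂ A] {G : ℝ → A}
    (hsa : ∀ ε, IsSelfAdjoint (G ε))
    (hmono : ∀ ε ε', 0 < ε → ε ≤ ε' → G ε ≤ G ε') :
    ∃ L, 0 ≤ L ∧ Tendsto (fun ε => NormedSpace.exp (G ε)) (𝓝[>] 0) (𝓝 L) := by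
  set c : ℝ := ‖G 1‖ with hc
  have hG : ∀ ε, 0 < ε → ε ≤ 1 → G ε ≤ algebraMap ℝ A c := fun ε h h' =>
    (hmono ε 1 h h').trans (IsSelfAdjoint.le_algebraMap_norm_self (hsa 1))
  have hspec : ∀ ε, 0 < ε → ε ≤ 1 → ∀ x ∈ spectrum ℝ (G ε), x ≤ c := fun ε h h' =>
    (le_algebraMap_iff_spectrum_le (hsa ε)).1 (hG ε h h')
  have hcont : ∀ ε, 0 < ε → ε ≤ 1 →
      ContinuousOn (fun x : ℝ => (c + 1 - x)⁻¹) (spectrum ℝ (G ε)) := by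
    intro ε h h'
    refine ContinuousOn.inv₀ (by fun_prop) fun x hx => ?_
    have := hspec ε h h' x hx
    linarith
  have hsp : ∀ ε, 0 < ε → ε ≤ 1 → IsStrictlyPositive (algebraMap ℝ A (c + 1) - G ε) := by
    intro ε h h'
    refine IsStrictlyPositive.of_le (a := 1) isStrictlyPositive_one ?_
    have h2 := hG ε h h'
    rw [map_add, map_one, add_sub_right_comm]
    exact le_add_of_nonneg_left (sub_nonneg.2 h2)
  let R : ℝ → A := fun ε => cfc (fun x : ℝ => (c + 1 - x)⁻¹) (G ε)
  have hR : ∀ ε, 0 < ε → ε ≤ 1 → R ε = Ring.inverse (algebraMap ℝ A (c + 1) - G ε) := by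
    intro ε h h'
    have h1 : cfc (fun x : ℝ => c + 1 - x) (G ε) = algebraMap ℝ A (c + 1) - G ε := by
      rw [cfc_sub (fun _ : ℝ => c + 1) (fun x : ℝ => x) (G ε), cfc_const (c + 1) (G ε) (hsa ε),
        cfc_id' ℝ (G ε) (hsa ε)]
    rw [← h1]
    refine cfc_inv (fun x : ℝ => c + 1 - x) (G ε) (fun x hx => ?_) (by fun_prop) (hsa ε)
    have := hspec ε h h' x hx
    linarith
  have hRsa : ∀ ε, IsSelfAdjoint (R ε) := fun ε => cfc_predicate _ _
  have hR0 : ∀ ε, 0 < ε → ε ≤ 1 → 0 ≤ R ε := fun ε h h' => by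
    refine cfc_nonneg fun x hx => ?_
    have := hspec ε h h' x hx
    exact inv_nonneg.2 (by linarith)
  have hR1 : ∀ ε, 0 < ε → ε ≤ 1 → R ε ≤ 1 := fun ε h h' => by
    refine cfc_le_one _ _ fun x hx => ?_
    have := hspec ε h h' x hx
    exact inv_le_one_of_one_le₀ (by linarith)
  obtain ⟨L, hL⟩ := tendsto_of_monotone_bounded_aux (R := R) (b := 1) one_pos hR0 hR1 (by
    intro ε ε' h h1 h2
    rw [hR ε h (h1.trans h2), hR ε' (h.trans_le h1) h2]
    refine CStarAlgebra.ringInverse_le_ringInverse ?_ (hsp ε' (h.trans_le h1) h2)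
    exact sub_le_sub_left (hmono ε ε' h h1) _)
  have hev : ∀ᶠ ε in 𝓝[>] (0 : ℝ), 0 < ε ∧ ε ≤ 1 := by
    filter_upwards [Ioc_mem_nhdsGT one_pos] with ε hε using hε
  have hL0 : 0 ≤ L := ge_of_tendsto hL (hev.mono fun ε h => hR0 ε h.1 h.2)
  have hLsa : IsSelfAdjoint L := .of_nonneg hL0
  have hL1 : L ≤ 1 := le_of_tendsto hL (hev.mono fun ε h => hR1 ε h.1 h.2)
  have hspecR : ∀ a : A, 0 ≤ a → a ≤ 1 → spectrum ℝ a ⊆ Set.Icc 0 1 := by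
    intro a h0 h1 x hx
    exact ⟨spectrum_nonneg_of_nonneg h0 hx, (CFC.le_one_iff a (.of_nonneg h0)).1 h1 x hx⟩
  let g : ℝ → ℝ := fun x => if x ≤ 0 then 0 else Real.exp (c + 1 - x⁻¹)
  have hg : Continuous g := by
    refine continuous_iff_continuousAt.2 fun x => ?_
    rcases lt_trichotomy x 0 with hx | rfl | hx
    · refine ContinuousAt.congr (f := fun _ => (0 : ℝ)) continuousAt_const ?_
      filter_upwards [Iio_mem_nhds hx] with y hy
      simp [g, le_of_lt (Set.mem_Iio.1 hy)]
    · have h0 : g 0 = 0 := by simp [g]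
      rw [continuousAt_iff_continuous_left'_right', ]
      constructor
      · refine ContinuousWithinAt.congr (f := fun _ => (0 : ℝ)) continuousWithinAt_const ?_ h0
        intro y hy
        simp [g, le_of_lt (Set.mem_Iio.1 hy)]
      · rw [ContinuousWithinAt, h0]
        have : Tendsto (fun x : ℝ => Real.exp (c + 1 - x⁻¹)) (𝓝[>] 0) (𝓝 0) := by
          refine Real.tendsto_exp_atBot.comp ?_
          exact tendsto_atBot_add_const_left _ (c + 1) (tendsto_neg_atTop_atBot.comp
            tendsto_inv_nhdsGT_zero)
        refine this.congr' ?_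
        filter_upwards [self_mem_nhdsWithin] with y hy
        simp [g, not_le.2 (Set.mem_Ioi.1 hy)]
    · refine ContinuousAt.congr (f := fun x => Real.exp (c + 1 - x⁻¹)) ?_ ?_
      · have := hx.ne'
        fun_prop (disch := assumption)
      · filter_upwards [Ioi_mem_nhds hx] with y hy
        simp [g, not_le.2 (Set.mem_Ioi.1 hy)]
  refine ⟨cfc g L, ?_, ?_⟩
  · refine cfc_nonneg fun x _ => ?_
    simp only [g]
    split_ifs
    exacts [le_rfl, (Real.exp_pos _).le]
  · have hlim : Tendsto (fun ε => cfc g (R ε)) (𝓝[>] 0) (𝓝 (cfc g L)) :=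
      hL.cfc isCompact_Icc g (hev.mono fun ε h => hspecR _ (hR0 ε h.1 h.2) (hR1 ε h.1 h.2))
        (Eventually.of_forall hRsa) (hspecR _ hL0 hL1) hLsa hg.continuousOn
    refine hlim.congr' (hev.mono fun ε h => ?_)
    simp only [R]
    rw [← CFC.real_exp_eq_normedSpace_exp (hsa ε)]
    rw [← cfc_comp' g (fun x : ℝ => (c + 1 - x)⁻¹) (G ε) hg.continuousOn (hcont ε h.1 h.2) (hsa ε)]
    refine cfc_congr fun x hx => ?_
    have := hspec ε h.1 h.2 x hx
    have h1 : 0 < (c + 1 - x)⁻¹ := inv_pos.2 (by linarith)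
    simp only [g, if_neg (not_le.2 h1), inv_inv]
    congr 1
    ring

theorem tendsto_exp_sum_log_aux [FiniteDimensional ℂ A] {ι : Type*} (s : Finset ι) (ρ : ι → A)
    (hρ : ∀ a ∈ s, 0 ≤ ρ a) :
    ∃ L, 0 ≤ L ∧ Tendsto
      (fun ε : ℝ => NormedSpace.exp (∑ a ∈ s, cfc Real.log (ρ a + (ε : ℂ) • (1 : A))))
      (𝓝[>] 0) (𝓝 L) := by
  refine tendsto_exp_of_monotone_aux (fun ε => ?_) ?_
  · exact isSelfAdjoint_sum _ fun a _ => cfc_predicate _ _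
  · intro ε ε' h h'
    have hε : ∀ r : ℝ, 0 < r → IsStrictlyPositive ((r : ℂ) • (1 : A)) := fun r hr => by
      have := IsStrictlyPositive.smul (A := A) hr isStrictlyPositive_one
      rwa [Complex.coe_smul]
    refine Finset.sum_le_sum fun a ha => ?_
    refine CFC.log_le_log ?_ (IsStrictlyPositive.nonneg_add (hρ a ha) (hε ε h))
    rw [Complex.coe_smul, Complex.coe_smul]
    gcongr

theorem tendsto_exp_sum_log_of_isStrictlyPositive_aux {ι : Type*} (s : Finset ι) (ρ : ι → A)
    (hρ : ∀ a ∈ s, IsStrictlyPositive (ρ a)) :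
    Tendsto (fun ε : ℝ => NormedSpace.exp (∑ a ∈ s, cfc Real.log (ρ a + (ε : ℂ) • (1 : A))))
      (𝓝[>] 0) (𝓝 (NormedSpace.exp (∑ a ∈ s, cfc Real.log (ρ a)))) := by
  let _ : NormedAlgebra ℚ A := NormedAlgebra.restrictScalars ℚ ℝ A
  have hexp : Continuous (NormedSpace.exp : A → A) := NormedSpace.exp_continuous
  refine (hexp.tendsto _).comp (tendsto_finsetSum _ fun a ha => ?_)
  have hsa : IsSelfAdjoint (ρ a) := (hρ a ha).isSelfAdjoint
  rcases subsingleton_or_nontrivial A with _ | _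
  · exact tendsto_const_nhds.congr fun ε => Subsingleton.elim _ _
  obtain ⟨m, hm, hma⟩ := (CFC.exists_pos_algebraMap_le_iff (A := A) (a := ρ a)).2
    fun x hx => (hρ a ha).spectrum_pos hx
  have hsa' : ∀ ε : ℝ, IsSelfAdjoint (ρ a + (ε : ℂ) • (1 : A)) := fun ε => by
    rw [Complex.coe_smul, ← Algebra.algebraMap_eq_smul_one]
    exact hsa.add (.algebraMap A (.all ε))
  have hspec : ∀ ε : ℝ, 0 ≤ ε → ε ≤ 1 →
      spectrum ℝ (ρ a + (ε : ℂ) • (1 : A)) ⊆ Set.Icc m (‖ρ a‖ + 1) := by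
    intro ε h0 h1 x hx
    have h2 := hsa' ε
    rw [Complex.coe_smul, ← Algebra.algebraMap_eq_smul_one] at hx h2
    refine ⟨(algebraMap_le_iff_le_spectrum (a := ρ a + algebraMap ℝ A ε) h2).1 ?_ x hx,
      (le_algebraMap_iff_spectrum_le (a := ρ a + algebraMap ℝ A ε) h2).1 ?_ x hx⟩
    · exact hma.trans (le_add_of_nonneg_right (algebraMap_nonneg A h0))
    · rw [map_add]
      exact add_le_add (IsSelfAdjoint.le_algebraMap_norm_self hsa)
        (algebraMap_mono A h1)
  have hev : ∀ᶠ ε in 𝓝[>] (0 : ℝ), 0 ≤ ε ∧ ε ≤ 1 := by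
    filter_upwards [Ioc_mem_nhdsGT one_pos] with ε hε using ⟨hε.1.le, hε.2⟩
  refine Tendsto.cfc isCompact_Icc Real.log ?_ (hev.mono fun ε h => hspec ε h.1 h.2)
    (Eventually.of_forall hsa') (by simpa using hspec 0 le_rfl zero_le_one) hsa
    (Real.continuousOn_log.mono fun x hx => ne_of_gt (lt_of_lt_of_le hm hx.1))
  have hc : Continuous fun ε : ℝ => ρ a + (ε : ℂ) • (1 : A) := by fun_prop
  simpa using (hc.tendsto 0).mono_left (nhdsWithin_le_nhds (s := Set.Ioi 0))

end StarProductConvergence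

/-- The `⋆`-product `⋆_{a ∈ s} ρ a` of a finite family of positive semidefinite operators on one
Hilbert space: `exp (∑ a ∈ s, log (ρ a))` when all `ρ a` are positive definite (see
`starProduct_eq_exp_sum_log`), and its extension by continuity from `ρ a + ε I`, `ε ↓ 0`, in the
positive semidefinite case, where the limit exists (see `starProduct_tendsto`). -/
noncomputable def starProduct {n ι : Type*} [Fintype n] [DecidableEq n] (s : Finset ι)
    (ρ : ι → Matrix n n ℂ) : Matrix n n ℂ :=
  limUnder (𝓝[>] (0 : ℝ)) fun ε =>
    NormedSpace.exp (∑ a ∈ s, cfc Real.log (ρ a + (ε : ℂ) • (1 : Matrix n n ℂ)))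

section StarProductFacts

open scoped Matrix.Norms.L2Operator MatrixOrder

variable {n ι : Type*} [Fintype n] [DecidableEq n] (s : Finset ι) (ρ : ι → Matrix n n ℂ)

theorem starProduct_tendsto (hρ : ∀ a ∈ s, (ρ a).PosSemidef) :
    Tendsto (fun ε : ℝ =>
      NormedSpace.exp (∑ a ∈ s, cfc Real.log (ρ a + (ε : ℂ) • (1 : Matrix n n ℂ))))
      (𝓝[>] 0) (𝓝 (starProduct s ρ)) := by
  obtain ⟨L, -, hL⟩ := tendsto_exp_sum_log_aux s ρ fun a ha => (hρ a ha).nonneg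
  exact tendsto_nhds_limUnder ⟨L, hL⟩

theorem starProduct_posSemidef (hρ : ∀ a ∈ s, (ρ a).PosSemidef) :
    (starProduct s ρ).PosSemidef := by
  obtain ⟨L, hL0, hL⟩ := tendsto_exp_sum_log_aux s ρ fun a ha => (hρ a ha).nonneg
  have : starProduct s ρ = L := hL.limUnder_eq
  rw [this]
  exact Matrix.nonneg_iff_posSemidef.1 hL0

theorem starProduct_eq_exp_sum_log (hρ : ∀ a ∈ s, (ρ a).PosDef) :
    starProduct s ρ = NormedSpace.exp (∑ a ∈ s, cfc Real.log (ρ a)) :=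
  (tendsto_exp_sum_log_of_isStrictlyPositive_aux s ρ
    fun a ha => (hρ a ha).isStrictlyPositive).limUnder_eq

end StarProductFacts

/-! ### Operators on tensor products

Each variable `i` carries the finite-dimensional Hilbert space `ℋ i = ℂ^(X i)`, given by a finite
index set `X i` of an orthonormal basis. For a finite set `S` of variables, the tensor product of
the `ℋ i`, `i ∈ S`, then has the product basis indexed by `Config X S`, and operators on it are
matrices indexed by `Config X S`. -/

section Operators

variable {V : Type u} [DecidableEq V] (X : V → Type w)

/-- Index set of the product basis of `⨂ i ∈ S, ℋ i`. -/
abbrev Config (S : Finset V) : Type (max u w) := ∀ i : {i // i ∈ S}, X i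

/-- Linear operators on `⨂ i ∈ S, ℋ i`. -/
abbrev Op (S : Finset V) : Type (max u w) := Matrix (Config X S) (Config X S) ℂ

variable {X}

/-- Restriction of a basis index to a smaller set of variables. -/
def restrict {S T : Finset V} (h : S ⊆ T) (x : Config X T) : Config X S := fun i => x ⟨i, h i.2⟩

/-- The basis index on `T` with components `z` on `W` and `x` off `W`. -/
def glue {T W : Finset V} (x : Config X (T \ W)) (z : Config X (T ∩ W)) : Config X T := fun i =>
  if h : i.1 ∈ W then z ⟨i, Finset.mem_inter.2 ⟨i.2, h⟩⟩ else x ⟨i, Finset.mem_sdiff.2 ⟨i.2, h⟩⟩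

variable [∀ i, Fintype (X i)]

open scoped Kronecker in
/-- The embedded operator `A ⊗ I` on `⨂ i ∈ T, ℋ i` of an operator `A` on `⨂ i ∈ S, ℋ i`. -/
def embed [∀ i, DecidableEq (X i)] {S T : Finset V} (h : S ⊆ T) (A : Op X S) : Op X T :=
  (A ⊗ₖ (1 : Op X (T \ S))).submatrix
    (fun x => (restrict h x, restrict Finset.sdiff_subset x))
    (fun x => (restrict h x, restrict Finset.sdiff_subset x))

/-- The partial trace over the Hilbert spaces `ℋ i`, `i ∈ W`. -/
def partialTrace {T : Finset V} (W : Finset V) (A : Op X T) : Op X (T \ W) :=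
  ∑ z : Config X (T ∩ W), A.submatrix (fun x => glue x z) (fun x => glue x z)

theorem embed_posSemidef [∀ i, DecidableEq (X i)] {S T : Finset V} (h : S ⊆ T) {A : Op X S} (hA : A.PosSemidef) :
    (embed h A).PosSemidef :=
  (hA.kronecker Matrix.PosSemidef.one).submatrix _

theorem partialTrace_posSemidef {T : Finset V} (W : Finset V) {A : Op X T} (hA : A.PosSemidef) :
    (partialTrace W A).PosSemidef :=
  Matrix.posSemidef_sum _ fun _ _ => hA.submatrix _

end Operators

/-! ### Bipartite graphs and closing a box -/

/-- A finite bipartite graph between a finite set `vars` of variable vertices (taken from `V`) and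
a finite set `Factor` of factor vertices; `nb a` is the set of neighbours of the factor vertex
`a`. -/
structure FactorGraph (V : Type u) [DecidableEq V] where
  vars : Finset V
  Factor : Type v
  [fintypeFactor : Fintype Factor]
  [decidableEqFactor : DecidableEq Factor]
  nb : Factor → Finset V
  nb_subset : ∀ a, nb a ⊆ vars

attribute [instance] FactorGraph.fintypeFactor FactorGraph.decidableEqFactor

namespace FactorGraph

variable {V : Type u} [DecidableEq V] (G : FactorGraph.{u, v} V)

/-- The underlying simple graph, on the disjoint union of variable and factor vertices. -/
def toSimpleGraph : SimpleGraph ({i // i ∈ G.vars} ⊕ G.Factor) :=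
  SimpleGraph.fromRel fun p q => ∃ i a, p = Sum.inl i ∧ q = Sum.inr a ∧ i.1 ∈ G.nb a

/-- The graph has no cycles. -/
def IsAcyclic : Prop := G.toSimpleGraph.IsAcyclic

/-- A box: a set of variable vertices and a set of factor vertices such that all neighbours of a
variable vertex in the box are in the box. -/
structure Box where
  vars : Finset V
  vars_subset : vars ⊆ G.vars
  factors : Finset G.Factor
  mem_factors : ∀ i ∈ vars, ∀ a, i ∈ G.nb a → a ∈ factors

variable {G}

/-- The variables on which the box operates: those inside the box, and the neighbours of the
factor vertices inside the box. -/
def Box.support (B : G.Box) : Finset V := B.vars ∪ B.factors.biUnion G.nb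

theorem Box.nb_subset_support (B : G.Box) {a : G.Factor} (ha : a ∈ B.factors) :
    G.nb a ⊆ B.support :=
  (Finset.subset_biUnion_of_mem G.nb ha).trans Finset.subset_union_right

theorem Box.support_subset (B : G.Box) : B.support ⊆ G.vars :=
  Finset.union_subset B.vars_subset (Finset.biUnion_subset.2 fun a _ => G.nb_subset a)

/-- Closing the box, on the level of graphs: the box is replaced by one new factor vertex `none`
adjacent to the variable vertices outside the box that were adjacent to a factor vertex inside. -/
def close (B : G.Box) : FactorGraph.{u, v} V where
  vars := G.vars \ B.vars
  Factor := Option {a : G.Factor // a ∉ B.factors}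
  nb
    | none => B.support \ B.vars
    | some a => G.nb a
  nb_subset
    | none => Finset.sdiff_subset_sdiff B.support_subset le_rfl
    | some a => fun i hi => Finset.mem_sdiff.2
        ⟨G.nb_subset a hi, fun hB => a.2 (B.mem_factors i hB a hi)⟩

end FactorGraph

/-! ### Quantum factor graphs -/

/-- A quantum factor graph on the bipartite graph `G`: each factor vertex `a` carries a positive
semidefinite operator on `⨂ i ∈ nb a, ℋ i`. -/
structure QuantumFactorGraph {V : Type u} [DecidableEq V] (X : V → Type w)
    [∀ i, Fintype (X i)] (G : FactorGraph.{u, v} V) where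
  op : ∀ a : G.Factor, Op X (G.nb a)
  posSemidef : ∀ a, (op a).PosSemidef

namespace QuantumFactorGraph

variable {V : Type u} [DecidableEq V] {X : V → Type w} [∀ i, Fintype (X i)]
  [∀ i, DecidableEq (X i)] {G : FactorGraph.{u, v} V}

/-- The global operator `⋆_a ρ_a`, on `⨂ i ∈ vars, ℋ i`. -/
noncomputable def globalOperator (Q : QuantumFactorGraph X G) : Op X G.vars :=
  starProduct Finset.univ fun a => embed (G.nb_subset a) (Q.op a)

/-- The partition sum `Z(G) = tr (⋆_a ρ_a)`. -/
noncomputable def partitionSum (Q : QuantumFactorGraph X G) : ℂ := Q.globalOperator.trace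

/-- The exterior operator of a box: the partial trace, over the Hilbert spaces in the box, of the
`⋆`-product of the local operators in the box. -/
noncomputable def exteriorOperator (Q : QuantumFactorGraph X G) (B : G.Box) :
    Op X (B.support \ B.vars) :=
  partialTrace B.vars <| starProduct B.factors.attach fun a =>
    embed (B.nb_subset_support a.2) (Q.op a)

/-- The closing-the-box operation: the box is replaced by one factor vertex which carries the
exterior operator; all other local operators are unchanged. -/
noncomputable def close (Q : QuantumFactorGraph X G) (B : G.Box) :
    QuantumFactorGraph X (G.close B) where
  op
    | none => Q.exteriorOperator B
    | some a => Q.op a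
  posSemidef
    | none => partialTrace_posSemidef _ <|
        starProduct_posSemidef _ _ fun a _ => embed_posSemidef _ (Q.posSemidef a)
    | some a => Q.posSemidef a

end QuantumFactorGraph

/-- `ClosingSequence G G'`: a finite sequence of closing-the-box operations that leads from the
graph `G` to the graph `G'`, in which every box contains exactly one variable vertex (so that every
operation traces out exactly one Hilbert space). -/
inductive ClosingSequence {V : Type u} [DecidableEq V] :
    FactorGraph.{u, v} V → FactorGraph.{u, v} V → Type (max u (v + 1))
  | nil (G : FactorGraph.{u, v} V) : ClosingSequence G G
  | cons {G G' : FactorGraph.{u, v} V} (B : G.Box) (i : V) (hB : B.vars = {i})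
      (s : ClosingSequence (G.close B) G') : ClosingSequence G G'

/-- The quantum factor graph that results from `Q` by the operations of a sequence. -/
noncomputable def ClosingSequence.run {V : Type u} [DecidableEq V] {X : V → Type w}
    [∀ i, Fintype (X i)] [∀ i, DecidableEq (X i)] :
    {G G' : FactorGraph.{u, v} V} → ClosingSequence G G' →
      QuantumFactorGraph X G → QuantumFactorGraph X G'
  | _, _, .nil _, Q => Q
  | _, _, .cons B _ _ s, Q => s.run (Q.close B)

end QFG

section ExpRemainder

variable {A : Type*} [NormedRing A] [NormedAlgebra ℝ A] [NormOneClass A] [CompleteSpace A]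

theorem NormedSpace.norm_exp_sub_sum_le_norm_pow_mul_exp (a : A) (n : ℕ) :
    ‖NormedSpace.exp a - ∑ k ∈ Finset.range n, ((k.factorial : ℝ)⁻¹) • a ^ k‖ ≤
      ‖a‖ ^ n * Real.exp ‖a‖ := by
  have h1 : HasSum (fun k : ℕ => ((k.factorial : ℝ)⁻¹) • a ^ k) (NormedSpace.exp a) :=
    NormedSpace.exp_series_hasSum_exp' (𝕂 := ℝ) a
  have h2 := (hasSum_nat_add_iff' n).2 h1
  have h3 : HasSum (fun k : ℕ => ‖a‖ ^ n * (((k.factorial : ℝ)⁻¹) • ‖a‖ ^ k))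
      (‖a‖ ^ n * Real.exp ‖a‖) := by
    rw [Real.exp_eq_exp_ℝ]
    exact (NormedSpace.exp_series_hasSum_exp' (𝕂 := ℝ) ‖a‖).mul_left _
  refine h2.norm_le_of_bounded h3 fun k => ?_
  have hf : ((k + n).factorial : ℝ)⁻¹ ≤ (k.factorial : ℝ)⁻¹ := by
    have := Nat.factorial_pos k
    gcongr
    omega
  calc ‖(((k + n).factorial : ℝ)⁻¹) • a ^ (k + n)‖
      ≤ ((k + n).factorial : ℝ)⁻¹ * ‖a‖ ^ (k + n) := by
        rw [norm_smul, Real.norm_of_nonneg (by positivity)]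
        gcongr
        exact norm_pow_le a _
    _ ≤ (k.factorial : ℝ)⁻¹ * ‖a‖ ^ (k + n) := by gcongr
    _ = ‖a‖ ^ n * (((k.factorial : ℝ)⁻¹) • ‖a‖ ^ k) := by
        rw [smul_eq_mul, pow_add]; ring

/-- The product `exp a * exp b` agrees up to fourth order with its Taylor polynomial of
degree three. -/
theorem NormedSpace.norm_exp_mul_exp_sub_le {a b : A} {r : ℝ} (ha : ‖a‖ ≤ r) (hb : ‖b‖ ≤ r) :
    ‖NormedSpace.exp a * NormedSpace.exp b - (1 + (a + b) +
      (2 : ℝ)⁻¹ • (a * a + (2 : ℝ) • (a * b) + b * b) +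
      (6 : ℝ)⁻¹ • (a * a * a + (3 : ℝ) • (a * a * b) + (3 : ℝ) • (a * b * b) + b * b * b))‖ ≤
      5 * r ^ 4 * Real.exp r ^ 2 := by
  have hr : 0 ≤ r := (norm_nonneg a).trans ha
  have rem : ∀ (c : A) (_ : ‖c‖ ≤ r) (n : ℕ),
      ‖NormedSpace.exp c - ∑ k ∈ Finset.range n, ((k.factorial : ℝ)⁻¹) • c ^ k‖ ≤
        r ^ n * Real.exp r := fun c hc n =>
    (NormedSpace.norm_exp_sub_sum_le_norm_pow_mul_exp c n).trans (by gcongr)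
  have he : 1 ≤ Real.exp r := Real.one_le_exp hr
  have a4 := rem a ha 4
  have b4 := rem b hb 4
  have b3 := rem b hb 3
  have b2 := rem b hb 2
  have b1 := rem b hb 1
  have b0 := rem b hb 0
  simp only [Finset.sum_range_succ, Finset.sum_range_zero, Nat.factorial, pow_zero, pow_one,
    Nat.cast_one, inv_one, one_smul, zero_add, mul_one, sub_zero, one_mul, Nat.succ_eq_add_one,
    Nat.reduceAdd, Nat.reduceMul, Nat.cast_ofNat] at a4 b4 b3 b2 b1 b0
  have split : NormedSpace.exp a * NormedSpace.exp b - (1 + (a + b) +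
      (2 : ℝ)⁻¹ • (a * a + (2 : ℝ) • (a * b) + b * b) +
      (6 : ℝ)⁻¹ • (a * a * a + (3 : ℝ) • (a * a * b) + (3 : ℝ) • (a * b * b) + b * b * b)) =
      (NormedSpace.exp a - (1 + a + (2 : ℝ)⁻¹ • a ^ 2 + (6 : ℝ)⁻¹ • a ^ 3)) * NormedSpace.exp b +
      (6 : ℝ)⁻¹ • (a ^ 3 * (NormedSpace.exp b - 1)) +
      (2 : ℝ)⁻¹ • (a ^ 2 * (NormedSpace.exp b - (1 + b))) +
      a * (NormedSpace.exp b - (1 + b + (2 : ℝ)⁻¹ • b ^ 2)) +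
      (NormedSpace.exp b - (1 + b + (2 : ℝ)⁻¹ • b ^ 2 + (6 : ℝ)⁻¹ • b ^ 3)) := by
    simp only [mul_sub, sub_mul, mul_add, add_mul, smul_add, smul_sub, smul_mul_assoc,
      mul_smul_comm, smul_smul, pow_succ, pow_zero, one_mul, mul_one, mul_assoc]
    norm_num
    module
  rw [split]
  have t1 : ‖(NormedSpace.exp a - (1 + a + (2 : ℝ)⁻¹ • a ^ 2 + (6 : ℝ)⁻¹ • a ^ 3)) *
      NormedSpace.exp b‖ ≤ r ^ 4 * Real.exp r * Real.exp r :=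
    (norm_mul_le _ _).trans (by gcongr)
  have hp : ∀ n, ‖a ^ n‖ ≤ r ^ n := fun n => (norm_pow_le a n).trans (by gcongr)
  have t2 : ‖(6 : ℝ)⁻¹ • (a ^ 3 * (NormedSpace.exp b - 1))‖ ≤ 1 * (r ^ 3 * (r * Real.exp r)) := by
    refine (norm_smul_le _ _).trans (mul_le_mul (by norm_num) ?_ (norm_nonneg _) zero_le_one)
    exact (norm_mul_le _ _).trans (mul_le_mul (hp 3) b1 (norm_nonneg _) (by positivity))
  have t3 : ‖(2 : ℝ)⁻¹ • (a ^ 2 * (NormedSpace.exp b - (1 + b)))‖ ≤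
      1 * (r ^ 2 * (r ^ 2 * Real.exp r)) := by
    refine (norm_smul_le _ _).trans (mul_le_mul (by norm_num) ?_ (norm_nonneg _) zero_le_one)
    exact (norm_mul_le _ _).trans (mul_le_mul (hp 2) b2 (norm_nonneg _) (by positivity))
  have t4 : ‖a * (NormedSpace.exp b - (1 + b + (2 : ℝ)⁻¹ • b ^ 2))‖ ≤
      r * (r ^ 3 * Real.exp r) :=
    (norm_mul_le _ _).trans (mul_le_mul ha b3 (norm_nonneg _) hr)
  refine (norm_add_le_of_le (norm_add_le_of_le (norm_add_le_of_le (norm_add_le_of_le t1 t2) t3)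
    t4) b4).trans ?_
  have : r ^ 4 * Real.exp r ≤ r ^ 4 * Real.exp r ^ 2 := by
    gcongr
    nlinarith
  nlinarith

/-- Under a bounded tracial functional, `exp (a + b)` and `exp a * exp b` agree up to fourth
order. -/
theorem norm_map_exp_add_sub_map_exp_mul_exp_le {F : Type*} [NormedAddCommGroup F]
    [NormedSpace ℝ F] (φ : A →L[ℝ] F) (hφ : ∀ x y, φ (x * y) = φ (y * x)) {a b : A} {r : ℝ}
    (ha : ‖a‖ ≤ r) (hb : ‖b‖ ≤ r) :
    ‖φ (NormedSpace.exp (a + b)) - φ (NormedSpace.exp a * NormedSpace.exp b)‖ ≤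
      ‖φ‖ * (21 * Real.exp (2 * r)) * r ^ 4 := by
  have hr : 0 ≤ r := (norm_nonneg a).trans ha
  have hab : ‖a + b‖ ≤ 2 * r := (norm_add_le_of_le ha hb).trans (by linarith)
  have h1 := (NormedSpace.norm_exp_sub_sum_le_norm_pow_mul_exp (a + b) 4).trans
    (show _ ≤ (2 * r) ^ 4 * Real.exp (2 * r) by gcongr)
  have h2 := NormedSpace.norm_exp_mul_exp_sub_le ha hb
  rw [← Real.exp_nat_mul, Nat.cast_ofNat] at h2
  have htaylor : φ (∑ k ∈ Finset.range 4, ((k.factorial : ℝ)⁻¹) • (a + b) ^ k) =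
      φ (1 + (a + b) + (2 : ℝ)⁻¹ • (a * a + (2 : ℝ) • (a * b) + b * b) +
      (6 : ℝ)⁻¹ • (a * a * a + (3 : ℝ) • (a * a * b) + (3 : ℝ) • (a * b * b) + b * b * b)) := by
    have e1 : φ (b * a) = φ (a * b) := hφ _ _
    have e2 : φ (a * (b * a)) = φ (a * (a * b)) := by rw [← mul_assoc, hφ]
    have e3 : φ (b * (a * a)) = φ (a * (a * b)) := by rw [hφ, mul_assoc]
    have e4 : φ (b * (a * b)) = φ (a * (b * b)) := by rw [hφ, mul_assoc]
    have e5 : φ (b * (b * a)) = φ (a * (b * b)) := by rw [← mul_assoc, hφ]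
    simp only [Finset.sum_range_succ, Finset.sum_range_zero, Nat.factorial, pow_zero,
      Nat.cast_one, inv_one, one_smul, zero_add, mul_one, one_mul, Nat.succ_eq_add_one,
      Nat.reduceAdd, Nat.reduceMul, Nat.cast_ofNat, pow_succ, mul_add, add_mul, mul_assoc, map_add,
      map_smul, e1, e2, e3, e4, e5]
    module
  have hdiff : φ (NormedSpace.exp (a + b)) - φ (NormedSpace.exp a * NormedSpace.exp b) =
      φ (NormedSpace.exp (a + b) - ∑ k ∈ Finset.range 4, ((k.factorial : ℝ)⁻¹) • (a + b) ^ k) -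
      φ (NormedSpace.exp a * NormedSpace.exp b - (1 + (a + b) +
        (2 : ℝ)⁻¹ • (a * a + (2 : ℝ) • (a * b) + b * b) +
        (6 : ℝ)⁻¹ • (a * a * a + (3 : ℝ) • (a * a * b) + (3 : ℝ) • (a * b * b) + b * b * b))) := by
    rw [map_sub φ (NormedSpace.exp (a + b)), map_sub φ (NormedSpace.exp a * NormedSpace.exp b),
      htaylor, sub_sub_sub_cancel_right]
  rw [hdiff]
  refine (norm_sub_le_of_le (φ.le_opNorm_of_le h1) (φ.le_opNorm_of_le h2)).trans (le_of_eq ?_)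
  ring

end ExpRemainder

namespace QFG

theorem exp_algebraMap_add {A : Type*} [CStarAlgebra A] (r : ℝ) (K : A) :
    NormedSpace.exp (algebraMap ℝ A r + K) = (Real.exp r : ℂ) • NormedSpace.exp K := by
  let _ : NormedAlgebra ℚ A := NormedAlgebra.restrictScalars ℚ ℝ A
  rw [NormedSpace.exp_add_of_commute (Algebra.commutes r K), Complex.coe_smul, Real.exp_eq_exp_ℝ,
    ← NormedSpace.algebraMap_exp_comm, ← Algebra.smul_def]

section StarAlg

variable {A : Type*} [CStarAlgebra A] [PartialOrder A] [StarOrderedRing A]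

theorem exp_mem_Icc {K : A} (hK : IsSelfAdjoint K) {r : ℝ} (hr : ‖K‖ ≤ r) :
    algebraMap ℝ A (Real.exp (-r)) ≤ NormedSpace.exp K ∧
      NormedSpace.exp K ≤ algebraMap ℝ A (Real.exp r) := by
  have hspec : ∀ x ∈ spectrum ℝ K, -r ≤ x ∧ x ≤ r := fun x hx =>
    ⟨(algebraMap_le_iff_le_spectrum hK).1 (by
      rw [map_neg]
      exact (neg_le_neg (algebraMap_mono A hr)).trans (hK.neg_algebraMap_norm_le_self)) x hx,
    (le_algebraMap_iff_spectrum_le hK).1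
      ((IsSelfAdjoint.le_algebraMap_norm_self hK).trans (algebraMap_mono A hr)) x hx⟩
  rw [← CFC.real_exp_eq_normedSpace_exp hK]
  exact ⟨(algebraMap_le_cfc_iff _ _ _).2 fun x hx => Real.exp_le_exp.2 (hspec x hx).1,
    (cfc_le_algebraMap_iff _ _ _).2 fun x hx => Real.exp_le_exp.2 (hspec x hx).2⟩

theorem isStrictlyPositive_smul_exp {c : ℝ} (hc : 0 < c) {K : A} (hK : IsSelfAdjoint K) :
    IsStrictlyPositive ((c : ℂ) • NormedSpace.exp K) := by
  rw [Complex.coe_smul]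
  refine IsStrictlyPositive.smul hc (.of_le (a := algebraMap ℝ A (Real.exp (-‖K‖))) ?_
    (exp_mem_Icc hK le_rfl).1)
  rw [Algebra.algebraMap_eq_smul_one]
  exact IsStrictlyPositive.smul (Real.exp_pos _) isStrictlyPositive_one

theorem log_smul_exp {c : ℝ} (hc : 0 < c) {K : A} (hK : IsSelfAdjoint K) :
    cfc Real.log ((c : ℂ) • NormedSpace.exp K) = algebraMap ℝ A (Real.log c) + K := by
  have h := CFC.log_smul' (NormedSpace.exp K) hc
    (by simpa using isStrictlyPositive_smul_exp one_pos hK)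
  rw [CFC.log_exp K hK] at h
  rw [Complex.coe_smul]
  exact h

/-- An element with spectrum between `exp (-r)` and `exp r` is the exponential of an element of
norm at most `r`. -/
theorem exists_exp_eq_of_le_of_le {P : A} {r : ℝ} (hr : 0 ≤ r)
    (h1 : algebraMap ℝ A (Real.exp (-r)) ≤ P) (h2 : P ≤ algebraMap ℝ A (Real.exp r)) :
    ∃ K : A, IsSelfAdjoint K ∧ ‖K‖ ≤ r ∧ NormedSpace.exp K = P := by
  have hpos : IsStrictlyPositive P := by
    refine .of_le (a := algebraMap ℝ A (Real.exp (-r))) ?_ h1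
    rw [Algebra.algebraMap_eq_smul_one]
    exact IsStrictlyPositive.smul (Real.exp_pos _) isStrictlyPositive_one
  have hP : IsSelfAdjoint P := hpos.isSelfAdjoint
  refine ⟨CFC.log P, .log, norm_cfc_le hr fun x hx => ?_, CFC.exp_log P hpos⟩
  have hx1 := (algebraMap_le_iff_le_spectrum hP).1 h1 x hx
  have hx2 := (le_algebraMap_iff_spectrum_le hP).1 h2 x hx
  have hx0 : 0 < x := (Real.exp_pos _).trans_le hx1
  rw [Real.norm_eq_abs, abs_le]
  exact ⟨(Real.le_log_iff_exp_le hx0).2 hx1, (Real.log_le_iff_le_exp hx0).2 hx2⟩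

theorem exists_exp_eq_one_add {H : A} (hH : IsSelfAdjoint H) (h : ‖H‖ ≤ 2⁻¹) :
    ∃ K : A, IsSelfAdjoint K ∧ ‖K‖ ≤ 2 * ‖H‖ ∧ NormedSpace.exp K = 1 + H := by
  have h0 := norm_nonneg H
  refine exists_exp_eq_of_le_of_le (by positivity) ?_ ?_
  · calc algebraMap ℝ A (Real.exp (-(2 * ‖H‖))) ≤ algebraMap ℝ A (1 + -‖H‖) := by
          refine algebraMap_mono A ?_
          rw [Real.exp_neg]
          refine inv_le_of_inv_le₀ (by linarith) (le_trans ?_ (Real.add_one_le_exp _))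
          rw [inv_le_iff_one_le_mul₀ (by linarith)]
          nlinarith
      _ ≤ 1 + H := by
          rw [map_add, map_one, map_neg]
          gcongr
          exact hH.neg_algebraMap_norm_le_self
  · calc 1 + H ≤ algebraMap ℝ A (1 + ‖H‖) := by
          rw [map_add, map_one]
          gcongr
          exact hH.le_algebraMap_norm_self
      _ ≤ algebraMap ℝ A (Real.exp (2 * ‖H‖)) :=
          algebraMap_mono A (by linarith [Real.add_one_le_exp (2 * ‖H‖)])

end StarAlg

section StarProductExp

open scoped Matrix.Norms.L2Operator MatrixOrder

variable {n ι : Type*} [Fintype n] [DecidableEq n]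

theorem starProduct_smul_exp (s : Finset ι) (c : ι → ℝ) (K : ι → Matrix n n ℂ)
    (hc : ∀ a ∈ s, 0 < c a) (hK : ∀ a ∈ s, IsSelfAdjoint (K a)) :
    starProduct s (fun a => (c a : ℂ) • NormedSpace.exp (K a)) =
      ((∏ a ∈ s, c a : ℝ) : ℂ) • NormedSpace.exp (∑ a ∈ s, K a) := by
  rw [starProduct_eq_exp_sum_log]
  · have h : ∀ a ∈ s, cfc Real.log ((c a : ℂ) • NormedSpace.exp (K a)) =
        algebraMap ℝ (Matrix n n ℂ) (Real.log (c a)) + K a := fun a ha =>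
      log_smul_exp (hc a ha) (hK a ha)
    rw [Finset.sum_congr rfl h, Finset.sum_add_distrib, ← map_sum, exp_algebraMap_add,
      Real.exp_sum, Finset.prod_congr rfl fun a ha => Real.exp_log (hc a ha)]
  · intro a ha
    exact Matrix.isStrictlyPositive_iff_posDef.1 (isStrictlyPositive_smul_exp (hc a ha) (hK a ha))

end StarProductExp

/-! ### Embedded operators and partial traces -/

section Operators

variable {V : Type u} [DecidableEq V] {X : V → Type w}

@[simp] theorem restrict_restrict {S T U : Finset V} (h : S ⊆ T) (h' : T ⊆ U) (x : Config X U) :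
    restrict h (restrict h' x) = restrict (h.trans h') x := rfl

theorem restrict_eq_iff {S T : Finset V} (h : S ⊆ T) (x y : Config X T) :
    restrict h x = restrict h y ↔ ∀ i (hi : i ∈ S), x ⟨i, h hi⟩ = y ⟨i, h hi⟩ :=
  ⟨fun e i hi => congrFun e ⟨i, hi⟩, fun e => funext fun i => e i.1 i.2⟩

/-- A product basis index on `T` consists of one on `S ⊆ T` and one on the complement. -/
def configEquiv {S T : Finset V} (h : S ⊆ T) : Config X T ≃ Config X S × Config X (T \ S) where
  toFun x := (restrict h x, restrict Finset.sdiff_subset x)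
  invFun p i := if hi : i.1 ∈ S then p.1 ⟨i, hi⟩ else p.2 ⟨i, Finset.mem_sdiff.2 ⟨i.2, hi⟩⟩
  left_inv x := by
    funext i
    by_cases hi : i.1 ∈ S <;> simp [hi, restrict]
  right_inv p := by
    refine Prod.ext ?_ ?_ <;> funext i
    · simp [restrict]
    · simp [restrict, (Finset.mem_sdiff.1 i.2).2]

variable [∀ i, Fintype (X i)] [∀ i, DecidableEq (X i)]

open scoped Kronecker in
theorem embed_eq_submatrix {S T : Finset V} (h : S ⊆ T) (A : Op X S) :
    embed h A = (A ⊗ₖ (1 : Op X (T \ S))).submatrix (configEquiv h) (configEquiv h) := rfl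

theorem embed_apply {S T : Finset V} (h : S ⊆ T) (A : Op X S) (x y : Config X T) :
    embed h A x y = A (restrict h x) (restrict h y) *
      if restrict (Finset.sdiff_subset (s := T) (t := S)) x = restrict Finset.sdiff_subset y
      then 1 else 0 := rfl

/-- The embedding of operators as a homomorphism of star algebras. -/
def embedHom {S T : Finset V} (h : S ⊆ T) : Op X S →⋆ₐ[ℂ] Op X T where
  toFun := embed h
  map_one' := by rw [embed_eq_submatrix, Matrix.one_kronecker_one, Matrix.submatrix_one_equiv]
  map_mul' A B := by
    rw [embed_eq_submatrix, embed_eq_submatrix, embed_eq_submatrix, Matrix.submatrix_mul_equiv,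
      ← Matrix.mul_kronecker_mul, mul_one]
  map_zero' := by rw [embed_eq_submatrix, Matrix.zero_kronecker]; rfl
  map_add' A B := by
    rw [embed_eq_submatrix, Matrix.add_kronecker]; rfl
  commutes' r := by
    rw [embed_eq_submatrix, Algebra.algebraMap_eq_smul_one, Matrix.smul_kronecker,
      Matrix.one_kronecker_one, Algebra.algebraMap_eq_smul_one, Matrix.submatrix_smul]
    simp
  map_star' A := by
    rw [embed_eq_submatrix, embed_eq_submatrix, Matrix.star_eq_conjTranspose,
      Matrix.star_eq_conjTranspose, Matrix.conjTranspose_submatrix, Matrix.conjTranspose_kronecker,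
      Matrix.conjTranspose_one]

theorem embedHom_apply {S T : Finset V} (h : S ⊆ T) (A : Op X S) : embedHom h A = embed h A := rfl

theorem embedHom_embedHom {S T U : Finset V} (h : S ⊆ T) (h' : T ⊆ U) (A : Op X S) :
    embedHom h' (embedHom h A) = embedHom (h.trans h') A := by
  ext x y
  simp only [embedHom_apply, embed_apply, restrict_restrict, mul_assoc]
  congr 1
  simp only [restrict_eq_iff, ← ite_and, mul_ite, mul_one, mul_zero]
  refine if_congr ⟨?_, fun e => ⟨fun i hi => ?_, fun i hi => ?_⟩⟩ rfl rfl
  · rintro ⟨e1, e2⟩ i hi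
    by_cases hT : i ∈ T
    · exact e2 i (by simp_all)
    · exact e1 i (by simp_all)
  · exact e i (by simp_all; exact fun hS => hi.2 (h hS))
  · exact e i (by simp_all; exact h' hi.1)

end Operators

@[to_additive]
theorem prod_attach_mul_prod_subtype_notMem {ι M : Type*} [Fintype ι] [DecidableEq ι]
    [CommMonoid M] (s : Finset ι) (f : ι → M) :
    (∏ a ∈ s.attach, f a) * ∏ a : {a // a ∉ s}, f a = ∏ a, f a := by
  rw [← Finset.prod_mul_prod_compl s f, Finset.prod_attach,
    Finset.prod_subtype sᶜ (fun _ => Finset.mem_compl)]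

section PartialTrace

variable {V : Type u} [DecidableEq V] {X : V → Type w}

/-- `glue` as an equivalence. -/
def glueEquiv (T W : Finset V) : Config X (T \ W) × Config X (T ∩ W) ≃ Config X T where
  toFun p := glue p.1 p.2
  invFun x := (restrict Finset.sdiff_subset x, restrict Finset.inter_subset_left x)
  left_inv p := by
    refine Prod.ext ?_ ?_ <;> funext i
    · simp [restrict, glue, (Finset.mem_sdiff.1 i.2).2]
    · simp [restrict, glue, (Finset.mem_inter.1 i.2).2]
  right_inv x := by
    funext i
    simp [restrict, glue]

theorem restrict_glue_sdiff {T W : Finset V} (x : Config X (T \ W)) (z : Config X (T ∩ W)) :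
    restrict Finset.sdiff_subset (glue x z) = x :=
  congrArg Prod.fst ((glueEquiv T W).left_inv (x, z))

theorem restrict_glue_of_subset {S T W : Finset V} (h : S ⊆ T) (x : Config X (T \ W))
    (z : Config X (T ∩ W)) :
    restrict h (glue x z) =
      glue (restrict (Finset.sdiff_subset_sdiff h le_rfl) x)
        (restrict (Finset.inter_subset_inter_right h) z) := rfl

theorem restrict_compl_glue_eq_iff {T W : Finset V} (x y : Config X (T \ W))
    (z z' : Config X (T ∩ W)) :
    restrict (S := T \ (T \ W)) Finset.sdiff_subset (glue x z) =
      restrict Finset.sdiff_subset (glue y z') ↔ z = z' := by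
  rw [restrict_eq_iff, funext_iff]
  refine ⟨fun e i => ?_, fun e i hi => ?_⟩
  · have hi := Finset.mem_inter.1 i.2
    simpa [glue, hi.2] using e i (by simp)
  · have hi' : i ∈ T ∧ i ∈ W := by simpa using hi
    simpa [glue, hi'.2] using e ⟨i, Finset.mem_inter.2 hi'⟩

variable [∀ i, Fintype (X i)]

theorem partialTrace_apply {T : Finset V} (W : Finset V) (A : Op X T) (x y : Config X (T \ W)) :
    partialTrace W A x y = ∑ z, A (glue x z) (glue y z) := by
  simp [partialTrace, Matrix.sum_apply]

theorem partialTrace_sub {T : Finset V} (W : Finset V) (A B : Op X T) :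
    partialTrace W (A - B) = partialTrace W A - partialTrace W B := by
  ext; simp [partialTrace_apply]

theorem partialTrace_smul {T : Finset V} (W : Finset V) (c : ℂ) (A : Op X T) :
    partialTrace W (c • A) = c • partialTrace W A := by
  ext; simp [partialTrace_apply, Finset.mul_sum]

variable [∀ i, DecidableEq (X i)]

theorem partialTrace_one {T : Finset V} (W : Finset V) :
    partialTrace W (1 : Op X T) = (Fintype.card (Config X (T ∩ W)) : ℂ) • 1 := by
  ext x y
  have h : ∀ z : Config X (T ∩ W), (1 : Op X T) (glue x z) (glue y z) = (1 : Op X (T \ W)) x y := by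
    intro z
    simp only [Matrix.one_apply]
    refine if_congr ⟨fun e => ?_, fun e => by rw [e]⟩ rfl rfl
    rw [← restrict_glue_sdiff x z, e, restrict_glue_sdiff]
  simp [partialTrace_apply, h]

theorem partialTrace_embed {T U : Finset V} (W : Finset V) (h : T ⊆ U) (hW : W ⊆ T) (A : Op X T) :
    partialTrace W (embed h A) = embed (Finset.sdiff_subset_sdiff h le_rfl) (partialTrace W A) := by
  ext x y
  let e : Config X (U ∩ W) ≃ Config X (T ∩ W) :=
    { toFun := restrict (Finset.inter_subset_inter_right h)
      invFun := restrict (fun i hi => Finset.mem_inter.2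
        ⟨hW (Finset.mem_inter.1 hi).2, (Finset.mem_inter.1 hi).2⟩)
      left_inv := fun _ => rfl
      right_inv := fun _ => rfl }
  rw [embed_apply, partialTrace_apply, partialTrace_apply, Finset.sum_mul]
  refine Fintype.sum_equiv e _ _ fun z => ?_
  rw [embed_apply, restrict_glue_of_subset, restrict_glue_of_subset]
  congr 1
  simp only [restrict_eq_iff]
  refine if_congr ⟨fun hx i hi => ?_, fun hx i hi => ?_⟩ rfl rfl
  · have hi' : (i ∈ U ∧ i ∉ W) ∧ (i ∈ T → i ∈ W) := by simpa using hi
    have := hx i (by simp; tauto)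
    simpa [glue, hi'.1.2] using this
  · have hi' : i ∈ U ∧ i ∉ T := by simpa using hi
    have hiW : i ∉ W := fun h => hi'.2 (hW h)
    simpa [glue, hiW] using hx i (by simp; tauto)

theorem trace_mul_embed {U : Finset V} (W : Finset V) (M : Op X U) (B : Op X (U \ W)) :
    (M * embed Finset.sdiff_subset B).trace = (partialTrace W M * B).trace := by
  simp only [Matrix.trace, Matrix.diag, Matrix.mul_apply]
  refine ((glueEquiv U W).sum_comp _).symm.trans ?_
  rw [Fintype.sum_prod_type]
  refine Finset.sum_congr rfl fun x _ => ?_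
  simp only [partialTrace_apply, Finset.sum_mul]
  conv_rhs => rw [Finset.sum_comm]
  refine Finset.sum_congr rfl fun z _ => ?_
  refine ((glueEquiv U W).sum_comp _).symm.trans ?_
  rw [Fintype.sum_prod_type]
  refine Finset.sum_congr rfl fun y _ => ?_
  simp [glueEquiv, embed_apply, restrict_glue_sdiff, restrict_compl_glue_eq_iff]

end PartialTrace

section Exponentials

open scoped Matrix.Norms.L2Operator MatrixOrder

variable {V : Type u} [DecidableEq V] {X : V → Type w} [∀ i, Fintype (X i)]
  [∀ i, DecidableEq (X i)]

theorem norm_embedHom_le {S T : Finset V} (h : S ⊆ T) (A : Op X S) : ‖embedHom h A‖ ≤ ‖A‖ :=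
  NonUnitalStarAlgHom.norm_apply_le (embedHom h) A

theorem norm_sum_embedHom_le {ι : Type*} (s : Finset ι) {S : ι → Finset V} {T : Finset V}
    (h : ∀ a, S a ⊆ T) (K : ∀ a, Op X (S a)) {r : ℝ} (hK : ∀ a, ‖K a‖ ≤ r) :
    ‖∑ a ∈ s, embedHom (h a) (K a)‖ ≤ s.card * r := by
  rw [← nsmul_eq_mul, ← Finset.sum_const]
  exact norm_sum_le_of_le _ fun a _ => (norm_embedHom_le (h a) (K a)).trans (hK a)

theorem embedHom_exp {S T : Finset V} (h : S ⊆ T) (A : Op X S) :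
    embedHom h (NormedSpace.exp A) = NormedSpace.exp (embedHom h A) := by
  let _ : NormedAlgebra ℚ (Op X S) := NormedAlgebra.restrictScalars ℚ ℝ _
  let _ : NormedAlgebra ℚ (Op X T) := NormedAlgebra.restrictScalars ℚ ℝ _
  exact NormedSpace.map_exp (embedHom h)
    ((embedHom h).toAlgHom.toLinearMap.continuous_of_finiteDimensional) A

theorem embed_smul_exp {S T : Finset V} (h : S ⊆ T) (c : ℂ) (A : Op X S) :
    embed h (c • NormedSpace.exp A) = c • NormedSpace.exp (embedHom h A) := by
  rw [← embedHom_apply, map_smul, embedHom_exp]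

theorem partialTrace_mono {T : Finset V} (W : Finset V) {A B : Op X T} (h : A ≤ B) :
    partialTrace W A ≤ partialTrace W B := by
  rw [Matrix.le_iff] at h ⊢
  rw [← partialTrace_sub]
  exact partialTrace_posSemidef W h

variable [∀ i, Nonempty (X i)]

theorem exists_partialTrace_exp_eq {T : Finset V} (W : Finset V) {A : Op X T}
    (hA : IsSelfAdjoint A) {r : ℝ} (hr : ‖A‖ ≤ r) :
    ∃ K : Op X (T \ W), IsSelfAdjoint K ∧ ‖K‖ ≤ r ∧
      partialTrace W (NormedSpace.exp A) =
        ((Fintype.card (Config X (T ∩ W)) : ℝ) : ℂ) • NormedSpace.exp K := by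
  set d : ℝ := ((Fintype.card (Config X (T ∩ W)) : ℕ) : ℝ) with hd
  have hd0 : 0 < d := Nat.cast_pos.2 Fintype.card_pos
  have hone : ∀ s : ℝ, partialTrace W (algebraMap ℝ (Op X T) s) =
      d • algebraMap ℝ (Op X (T \ W)) s := by
    intro s
    rw [Algebra.algebraMap_eq_smul_one, Algebra.algebraMap_eq_smul_one, ← Complex.coe_smul,
      partialTrace_smul, partialTrace_one, ← Complex.coe_smul, ← Complex.coe_smul, smul_comm, hd,
      Complex.ofReal_natCast]
  obtain ⟨h1, h2⟩ := exp_mem_Icc hA hr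
  have h1' := partialTrace_mono W h1
  have h2' := partialTrace_mono W h2
  rw [hone] at h1' h2'
  obtain ⟨K, hK, hKr, hexp⟩ := exists_exp_eq_of_le_of_le
    (P := d⁻¹ • partialTrace W (NormedSpace.exp A)) ((norm_nonneg A).trans hr)
    ((le_inv_smul_iff_of_pos hd0).2 h1') ((inv_smul_le_iff_of_pos hd0).2 h2')
  refine ⟨K, hK, hKr, ?_⟩
  rw [hexp, Complex.coe_smul, smul_inv_smul₀ hd0.ne']

theorem exists_norm_trace_exp_add_sub_le (T : Finset V) (R : ℝ) :
    ∃ C ≥ (0 : ℝ), ∀ (A B : Op X T) (r : ℝ), ‖A‖ ≤ r → ‖B‖ ≤ r → r ≤ R →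
      ‖(NormedSpace.exp (A + B)).trace - (NormedSpace.exp A * NormedSpace.exp B).trace‖ ≤
        C * r ^ 4 := by
  let φ : Op X T →L[ℝ] ℂ :=
    LinearMap.toContinuousLinearMap (Matrix.traceLinearMap (Config X T) ℝ ℂ)
  refine ⟨‖φ‖ * (21 * Real.exp (2 * R)), by positivity, fun A B r hA hB hr => ?_⟩
  refine (norm_map_exp_add_sub_map_exp_mul_exp_le φ Matrix.trace_mul_comm hA hB).trans ?_
  gcongr

/-- Replacing a local operator `exp A` by its partial trace `d • exp K` changes the partition sum
only in fourth order. -/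
theorem exists_norm_trace_exp_sub_le {T U : Finset V} (W : Finset V) (h : T ⊆ U) (hW : W ⊆ T)
    (R d : ℝ) : ∃ C ≥ (0 : ℝ), ∀ (A : Op X T) (K : Op X (T \ W)) (B : Op X (U \ W)) (r : ℝ),
      ‖A‖ ≤ r → ‖K‖ ≤ r → ‖B‖ ≤ r → r ≤ R →
      partialTrace W (NormedSpace.exp A) = (d : ℂ) • NormedSpace.exp K →
      ‖(d : ℂ) * (NormedSpace.exp (embedHom (Finset.sdiff_subset_sdiff h le_rfl) K + B)).trace -
        (NormedSpace.exp (embedHom h A + embedHom Finset.sdiff_subset B)).trace‖ ≤ C * r ^ 4 := by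
  obtain ⟨C₁, hC₁, h₁⟩ := exists_norm_trace_exp_add_sub_le (X := X) (U \ W) R
  obtain ⟨C₂, hC₂, h₂⟩ := exists_norm_trace_exp_add_sub_le (X := X) U R
  refine ⟨|d| * C₁ + C₂, by positivity, fun A K B r hA hK hB hr hd => ?_⟩
  have e₁ := h₁ (embedHom (Finset.sdiff_subset_sdiff h le_rfl) K) B r
    ((norm_embedHom_le _ _).trans hK) hB hr
  have e₂ := h₂ (embedHom h A) (embedHom Finset.sdiff_subset B) r
    ((norm_embedHom_le _ _).trans hA) ((norm_embedHom_le _ _).trans hB) hr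
  have key : (NormedSpace.exp (embedHom h A) *
      NormedSpace.exp (embedHom Finset.sdiff_subset B)).trace =
      (d : ℂ) * (NormedSpace.exp (embedHom (Finset.sdiff_subset_sdiff h le_rfl) K) *
        NormedSpace.exp B).trace := by
    rw [← embedHom_exp, ← embedHom_exp, ← embedHom_exp, embedHom_apply, embedHom_apply,
      trace_mul_embed, partialTrace_embed W h hW, hd, ← embedHom_apply, map_smul, smul_mul_assoc,
      Matrix.trace_smul, smul_eq_mul]
  rw [key] at e₂
  have e₁' := mul_le_mul_of_nonneg_left e₁ (abs_nonneg d)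
  rw [← Real.norm_eq_abs, ← Complex.norm_real, ← norm_mul, mul_sub] at e₁'
  rw [norm_sub_rev] at e₂
  rw [Complex.norm_real, Real.norm_eq_abs] at e₁'
  refine (norm_sub_le_norm_sub_add_norm_sub _ _ _).trans ((add_le_add e₁' e₂).trans (le_of_eq ?_))
  ring

end Exponentials

theorem FactorGraph.Box.nb_subset_sdiff {V : Type u} [DecidableEq V] {G : FactorGraph.{u, v} V}
    (B : G.Box) {a : G.Factor} (ha : a ∉ B.factors) : G.nb a ⊆ G.vars \ B.vars :=
  (G.close B).nb_subset (some ⟨a, ha⟩)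

theorem exists_closingSequence_trivial {V : Type u} [DecidableEq V] :
    ∀ (n : ℕ) (G : FactorGraph.{u, v} V), G.vars.card = n →
    ∃ G₀ : FactorGraph.{u, v} V, Nonempty (ClosingSequence G G₀) ∧
      G₀.vars = ∅ ∧ (G.vars.Nonempty → Fintype.card G₀.Factor = 1) := by
  intro n
  induction n with
  | zero =>
    intro G hG
    have hv := Finset.card_eq_zero.1 hG
    exact ⟨G, ⟨.nil G⟩, hv, fun h => absurd hv h.ne_empty⟩
  | succ n ih =>
    intro G hG
    obtain ⟨i, hi⟩ : G.vars.Nonempty := Finset.card_pos.1 (by omega)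
    let B : G.Box := ⟨{i}, Finset.singleton_subset_iff.2 hi, Finset.univ,
      fun _ _ a _ => Finset.mem_univ a⟩
    have hvars : (G.close B).vars = G.vars \ {i} := rfl
    have hcard : (G.close B).vars.card = n := by
      rw [hvars, Finset.card_sdiff_of_subset (Finset.singleton_subset_iff.2 hi), hG]
      simp
    rcases n.eq_zero_or_pos with rfl | hn
    · have : IsEmpty {a : G.Factor // a ∉ B.factors} := ⟨fun a => a.2 (Finset.mem_univ a.1)⟩
      refine ⟨G.close B, ⟨.cons B i rfl (.nil _)⟩, Finset.card_eq_zero.1 hcard, fun _ => ?_⟩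
      have : Fintype.card (Option {a : G.Factor // a ∉ B.factors}) = 1 := by
        rw [Fintype.card_option, Fintype.card_eq_zero]
      exact this
    · obtain ⟨G₀, ⟨s⟩, hs, h1⟩ := ih (G.close B) hcard
      exact ⟨G₀, ⟨.cons B i rfl s⟩, hs, fun _ => h1 (Finset.card_pos.1 (by omega))⟩

section ClosingBoxes

open scoped Matrix.Norms.L2Operator MatrixOrder

variable {V : Type u} [DecidableEq V] {X : V → Type w} [∀ i, Fintype (X i)]
  [∀ i, DecidableEq (X i)] {G : FactorGraph.{u, v} V}

theorem QuantumFactorGraph.partitionSum_eq (Q : QuantumFactorGraph X G) (c : G.Factor → ℝ)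
    (hc : ∀ a, 0 < c a) (K : ∀ a, Op X (G.nb a)) (hK : ∀ a, IsSelfAdjoint (K a))
    (hQ : ∀ a, Q.op a = (c a : ℂ) • NormedSpace.exp (K a)) :
    Q.partitionSum = ((∏ a, c a : ℝ) : ℂ) *
      (NormedSpace.exp (∑ a, embedHom (G.nb_subset a) (K a))).trace := by
  rw [partitionSum, globalOperator]
  simp only [hQ, embed_smul_exp]
  rw [starProduct_smul_exp _ _ _ (fun a _ => hc a) fun a _ => (hK a).map _, Matrix.trace_smul,
    smul_eq_mul]

theorem QuantumFactorGraph.exteriorOperator_eq (Q : QuantumFactorGraph X G) (B : G.Box)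
    (c : G.Factor → ℝ) (hc : ∀ a, 0 < c a) (K : ∀ a, Op X (G.nb a))
    (hK : ∀ a, IsSelfAdjoint (K a)) (hQ : ∀ a, Q.op a = (c a : ℂ) • NormedSpace.exp (K a)) :
    Q.exteriorOperator B = ((∏ a ∈ B.factors.attach, c a : ℝ) : ℂ) • partialTrace B.vars
      (NormedSpace.exp
        (∑ a ∈ B.factors.attach, embedHom (B.nb_subset_support a.2) (K a))) := by
  rw [exteriorOperator]
  simp only [hQ, embed_smul_exp]
  rw [starProduct_smul_exp _ (fun a : {a // a ∈ B.factors} => c a) _ (fun a _ => hc a)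
    fun a _ => (hK a).map _, partialTrace_smul]

theorem QuantumFactorGraph.globalOperator_posSemidef (Q : QuantumFactorGraph X G) :
    Q.globalOperator.PosSemidef :=
  starProduct_posSemidef _ _ fun a _ => embed_posSemidef _ (Q.posSemidef a)

theorem QuantumFactorGraph.globalOperator_eq_partitionSum_smul (Q : QuantumFactorGraph X G)
    (hG : G.vars = ∅) : Q.globalOperator = Q.partitionSum • 1 := by
  have : IsEmpty {i // i ∈ G.vars} := by rw [hG]; infer_instance
  ext x y
  obtain rfl := Subsingleton.elim x y
  have h : Q.partitionSum = Q.globalOperator x x := Fintype.sum_subsingleton _ x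
  simp [h]

variable [∀ i, Nonempty (X i)]

theorem QuantumFactorGraph.exists_norm_partitionSum_close_sub_le (B : G.Box) {M : ℝ}
    (hM : 0 ≤ M) :
    ∃ M' ≥ (0 : ℝ), ∃ d > (0 : ℝ), ∃ C ≥ (0 : ℝ), ∀ t : ℝ, 0 ≤ t → t ≤ 1 →
      ∀ c : G.Factor → ℝ, (∀ a, 0 < c a) → ∀ K : (∀ a, Op X (G.nb a)),
      (∀ a, IsSelfAdjoint (K a)) → (∀ a, ‖K a‖ ≤ M * t) → ∀ Q : QuantumFactorGraph X G,
      (∀ a, Q.op a = (c a : ℂ) • NormedSpace.exp (K a)) →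
      (∃ c' : (G.close B).Factor → ℝ, ∃ K' : (∀ a, Op X ((G.close B).nb a)),
        (∀ a, 0 < c' a) ∧ ∏ a, c' a = d * ∏ a, c a ∧ (∀ a, IsSelfAdjoint (K' a)) ∧
        (∀ a, ‖K' a‖ ≤ M' * t) ∧
        ∀ a, (Q.close B).op a = (c' a : ℂ) • NormedSpace.exp (K' a)) ∧
      ‖(Q.close B).partitionSum - Q.partitionSum‖ ≤ C * (∏ a, c a) * t ^ 4 := by
  set N : ℝ := Fintype.card G.Factor + 1 with hN
  set d : ℝ := ((Fintype.card (Config X (B.support ∩ B.vars)) : ℕ) : ℝ) with hd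
  have hd0 : 0 < d := Nat.cast_pos.2 Fintype.card_pos
  have hWT : B.vars ⊆ B.support := Finset.subset_union_left
  obtain ⟨C, hC, hstep⟩ :=
    exists_norm_trace_exp_sub_le (X := X) B.vars B.support_subset hWT (N * M) d
  refine ⟨N * M, by positivity, d, hd0, C * (N * M) ^ 4, by positivity, ?_⟩
  intro t ht0 ht1 c hc K hK hKt Q hQ
  have hMt : 0 ≤ M * t := by positivity
  set A : Op X B.support :=
    ∑ a ∈ B.factors.attach, embedHom (B.nb_subset_support a.2) (K a) with hA
  set E : Op X (G.vars \ B.vars) :=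
    ∑ a : {a // a ∉ B.factors}, embedHom (B.nb_subset_sdiff a.2) (K a) with hE
  have hAr : ‖A‖ ≤ N * M * t := by
    refine (norm_sum_embedHom_le B.factors.attach
      (fun a => B.nb_subset_support a.2) (fun a => K a.1) fun a => hKt a.1).trans ?_
    rw [Finset.card_attach, mul_assoc]
    gcongr
    exact (Nat.cast_le.2 (Finset.card_le_univ _)).trans (le_add_of_nonneg_right zero_le_one)
  have hEr : ‖E‖ ≤ N * M * t := by
    refine (norm_sum_embedHom_le Finset.univ
      (fun a : {a // a ∉ B.factors} => B.nb_subset_sdiff a.2) (fun a => K a.1)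
      fun a => hKt a.1).trans ?_
    rw [mul_assoc]
    gcongr
    exact (Nat.cast_le.2 (Fintype.card_subtype_le _)).trans (le_add_of_nonneg_right zero_le_one)
  have hAsa : IsSelfAdjoint A := isSelfAdjoint_sum _ fun a _ => (hK a).map _
  obtain ⟨L, hL, hLr, hexp⟩ := exists_partialTrace_exp_eq B.vars hAsa hAr
  let c' : (G.close B).Factor → ℝ
    | none => d * ∏ a ∈ B.factors.attach, c a
    | some a => c a
  let K' : ∀ a, Op X ((G.close B).nb a)
    | none => L
    | some a => K a
  have hc' : ∀ a, 0 < c' a := by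
    rintro (_ | a)
    · exact mul_pos hd0 (Finset.prod_pos fun a _ => hc a)
    · exact hc a
  have hK' : ∀ a, IsSelfAdjoint (K' a) := by
    rintro (_ | a)
    exacts [hL, hK a]
  have hK'r : ∀ a, ‖K' a‖ ≤ N * M * t := by
    rintro (_ | a)
    · exact hLr
    · refine (hKt a).trans ?_
      rw [mul_assoc]
      exact le_mul_of_one_le_left hMt (le_add_of_nonneg_left (Nat.cast_nonneg _))
  have hprod : ∏ a, c' a = d * ∏ a, c a := by
    have h1 : ∏ a, c' a = c' none * ∏ a : {a // a ∉ B.factors}, c' (some a) :=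
      Fintype.prod_option _
    rw [h1, ← prod_attach_mul_prod_subtype_notMem B.factors c, ← mul_assoc]
  have hop : ∀ a, (Q.close B).op a = (c' a : ℂ) • NormedSpace.exp (K' a) := by
    rintro (_ | a)
    · refine (Q.exteriorOperator_eq B c hc K hK hQ).trans ?_
      rw [hexp, smul_smul, ← Complex.ofReal_mul, mul_comm]
      rfl
    · exact hQ a
  refine ⟨⟨c', K', hc', hprod, hK', hK'r, hop⟩, ?_⟩
  have hsum' : ∑ a, embedHom ((G.close B).nb_subset a) (K' a) =
      embedHom (Finset.sdiff_subset_sdiff B.support_subset le_rfl) L + E :=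
    Fintype.sum_option _
  have hsum : ∑ a, embedHom (G.nb_subset a) (K a) =
      embedHom B.support_subset A + embedHom Finset.sdiff_subset E := by
    rw [← sum_attach_add_sum_subtype_notMem B.factors, hA, hE, map_sum, map_sum]
    simp only [embedHom_embedHom]
  rw [(Q.close B).partitionSum_eq c' hc' K' hK' hop, Q.partitionSum_eq c hc K hK hQ, hprod, hsum,
    hsum']
  have hP : 0 ≤ ∏ a, c a := Finset.prod_nonneg fun a _ => (hc a).le
  have hfin := hstep A L E (N * M * t) hAr hLr hEr
    (mul_le_of_le_one_right (by positivity) ht1) hexp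
  have hfac : ∀ x y : ℂ, ((d * ∏ a, c a : ℝ) : ℂ) * x - ((∏ a, c a : ℝ) : ℂ) * y =
      ((∏ a, c a : ℝ) : ℂ) * ((d : ℂ) * x - y) := by
    intro x y
    rw [Complex.ofReal_mul]
    ring
  rw [hfac]
  rw [norm_mul, Complex.norm_real, Real.norm_of_nonneg hP]
  refine (mul_le_mul_of_nonneg_left hfin hP).trans (le_of_eq ?_)
  ring

theorem ClosingSequence.exists_norm_partitionSum_run_sub_le {G G' : FactorGraph.{u, v} V}
    (s : ClosingSequence G G') : ∀ {M : ℝ}, 0 ≤ M →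
    ∃ C ≥ (0 : ℝ), ∀ t : ℝ, 0 ≤ t → t ≤ 1 →
      ∀ c : G.Factor → ℝ, (∀ a, 0 < c a) → ∀ K : (∀ a, Op X (G.nb a)),
      (∀ a, IsSelfAdjoint (K a)) → (∀ a, ‖K a‖ ≤ M * t) → ∀ Q : QuantumFactorGraph X G,
      (∀ a, Q.op a = (c a : ℂ) • NormedSpace.exp (K a)) →
      ‖(s.run Q).partitionSum - Q.partitionSum‖ ≤ C * (∏ a, c a) * t ^ 4 := by
  induction s with
  | nil G =>
    intro M _
    refine ⟨0, le_rfl, fun t _ _ c _ K _ _ Q _ => ?_⟩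
    simp [ClosingSequence.run]
  | cons B i hB s ih =>
    intro M hM
    obtain ⟨M', hM', d, hd, C₁, hC₁, h₁⟩ :=
      QuantumFactorGraph.exists_norm_partitionSum_close_sub_le (X := X) B hM
    obtain ⟨C₂, hC₂, h₂⟩ := ih hM'
    refine ⟨C₂ * d + C₁, by positivity, fun t ht0 ht1 c hc K hK hKt Q hQ => ?_⟩
    obtain ⟨⟨c', K', hc', hprod, hK', hK't, hop⟩, e₁⟩ := h₁ t ht0 ht1 c hc K hK hKt Q hQ
    have e₂ := h₂ t ht0 ht1 c' hc' K' hK' hK't (Q.close B) hop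
    rw [hprod] at e₂
    refine (norm_sub_le_norm_sub_add_norm_sub _ _ _).trans
      ((add_le_add e₂ e₁).trans (le_of_eq ?_))
    ring

theorem ClosingSequence.exists_norm_partitionSum_run_sub_le_of_isHermitian
    {G G' : FactorGraph.{u, v} V} (s : ClosingSequence G G') (H : ∀ a : G.Factor, Op X (G.nb a))
    (hH : ∀ a, (H a).IsHermitian) :
    ∃ C > (0 : ℝ), ∃ δ > (0 : ℝ), ∀ t : ℝ, |t| < δ →
      ∀ c : G.Factor → ℝ, (∀ a, 0 < c a) → ∀ Q : QuantumFactorGraph X G,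
        (∀ a, Q.op a = (c a : ℂ) • (1 + (t : ℂ) • H a)) →
          ‖(s.run Q).partitionSum - Q.partitionSum‖ ≤ C * (∏ a, c a) * |t| ^ 4 := by
  have hM0 : 0 ≤ ∑ a, ‖H a‖ := Finset.sum_nonneg fun a _ => norm_nonneg _
  set M : ℝ := ∑ a, ‖H a‖ with hM
  have hHM : ∀ a, ‖H a‖ ≤ M := fun a =>
    Finset.single_le_sum (f := fun a => ‖H a‖) (fun a _ => norm_nonneg _) (Finset.mem_univ a)
  obtain ⟨C, hC, hs⟩ :=
    s.exists_norm_partitionSum_run_sub_le (X := X) (M := 2 * M) (by positivity)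
  refine ⟨C + 1, by positivity, (2 * (M + 1))⁻¹, by positivity, fun t ht c hc Q hQ => ?_⟩
  have hP : 0 ≤ ∏ a, c a := Finset.prod_nonneg fun a _ => (hc a).le
  have ht' : |t| * (2 * (M + 1)) < 1 := by
    rwa [← one_div, lt_div_iff₀ (by positivity)] at ht
  have hnorm : ∀ a, ‖(t : ℂ) • H a‖ = |t| * ‖H a‖ := fun a => by
    rw [norm_smul, Complex.norm_real, Real.norm_eq_abs]
  have hex : ∀ a, ∃ K : Op X (G.nb a), IsSelfAdjoint K ∧ ‖K‖ ≤ 2 * M * |t| ∧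
      NormedSpace.exp K = 1 + (t : ℂ) • H a := by
    intro a
    have hsa : IsSelfAdjoint ((t : ℂ) • H a) := by
      rw [Complex.coe_smul]
      exact IsSelfAdjoint.smul (IsSelfAdjoint.all t) (hH a)
    have hle : |t| * ‖H a‖ ≤ |t| * M := mul_le_mul_of_nonneg_left (hHM a) (abs_nonneg t)
    obtain ⟨K, hK, hKn, hexp⟩ := exists_exp_eq_one_add hsa (by
      rw [hnorm]
      linarith [abs_nonneg t])
    refine ⟨K, hK, hKn.trans ?_, hexp⟩
    rw [hnorm]
    linarith
  choose K hK hKn hexp using hex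
  refine (hs |t| (abs_nonneg t) ?_ c hc K hK hKn Q fun a => by rw [hQ, hexp]).trans ?_
  · nlinarith [abs_nonneg t]
  · gcongr
    linarith

end ClosingBoxes

end QFG

theorem mainTheorem7 {V : Type u} [DecidableEq V] (X : V → Type w) [∀ i, Fintype (X i)]
    [∀ i, DecidableEq (X i)] [∀ i, Nonempty (X i)] (G : QFG.FactorGraph.{u, v} V)
    (hG : G.IsAcyclic) :
    (∃ G₀ : QFG.FactorGraph.{u, v} V, Nonempty (QFG.ClosingSequence G G₀) ∧
      G₀.vars = ∅ ∧ (G.vars.Nonempty → Fintype.card G₀.Factor = 1)) ∧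
    ∀ (G₀ : QFG.FactorGraph.{u, v} V) (s : QFG.ClosingSequence G G₀), G₀.vars = ∅ →
      ∃ Zhat : QFG.QuantumFactorGraph X G → ℝ,
        (∀ Q, 0 ≤ Zhat Q ∧ (s.run Q).globalOperator = (Zhat Q : ℂ) • 1) ∧
        ∀ H : (∀ a : G.Factor, QFG.Op X (G.nb a)), (∀ a, (H a).IsHermitian) →
          ∃ C > (0 : ℝ), ∃ δ > (0 : ℝ), ∀ t : ℝ, |t| < δ →
            ∀ c : G.Factor → ℝ, (∀ a, 0 < c a) → ∀ Q : QFG.QuantumFactorGraph X G,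
              (∀ a, Q.op a = (c a : ℂ) • (1 + (t : ℂ) • H a)) →
                ‖(Zhat Q : ℂ) - Q.partitionSum‖ ≤ C * (∏ a, c a) * |t| ^ 4 := by
  refine ⟨QFG.exists_closingSequence_trivial _ G rfl, fun G₀ s hG₀ => ?_⟩
  have hZ : ∀ Q : QFG.QuantumFactorGraph X G, 0 ≤ (s.run Q).partitionSum.re ∧
      ((s.run Q).partitionSum.re : ℂ) = (s.run Q).partitionSum := fun Q => by
    have h := Complex.nonneg_iff.1 (s.run Q).globalOperator_posSemidef.trace_nonneg
    exact ⟨h.1, Complex.ext rfl h.2⟩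
  refine ⟨fun Q => (s.run Q).partitionSum.re, fun Q => ⟨(hZ Q).1, ?_⟩, fun H hH => ?_⟩
  · rw [(hZ Q).2]
    exact (s.run Q).globalOperator_eq_partitionSum_smul hG₀
  simpa only [(hZ _).2] using s.exists_norm_partitionSum_run_sub_le_of_isHermitian H hH
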